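/- Let $d\ge 2$, $1\le k\le d$, and let $\lambda=(\lambda_1,\dots,\lambda_d)$ be fixed with $1\ge\lambda_1\ge\dots\ge\lambda_k>\lambda_{k+1}=\dots=\lambda_d=0$; if $k=d$, assume in addition that the $\lambda_i$ are not all equal. Put $D_\lambda=\mathrm{diag}(\lambda_1,\dots,\lambda_d)$, $s_i=\mathrm{tr}(D_\lambda^i)$, and $$a_1=\frac{d(d+2)(d-1)}{-2s_1^2+2d s_2},\qquad a_2=\frac{(d+1)s_1^2-2s_2}{-2s_1^2+2d s_2}.$$ Let $\mathscr H_d$ be the space of symmetric matrices in $\mathbb R^{d\times d}$ with $\langle X,Y\rangle=\mathrm{tr}(XY^{*})$, let $\mathcal G_{\lambda,d}=\{OD_\lambda O^{*}: O\in \mathcal O(d)\}$, and let $\sigma_{\lambda,d}$ be the probability measure on $\mathcal G_{\lambda,d}$ induced by the Haar probability measure on the orthogonal group $\mathcal O(d)$ via $O\mapsto OD_\lambda O^{*}$. Let $\mathcal P$ be a $\mathcal G_{\lambda,d}$-valued random variable which is a random cubature of strength $2$, i.e. $$\mathbb E\big(\langle \mathcal P,X\rangle^2\big)=\int_{\mathcal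 G_{\lambda,d}}\langle P,X\rangle^2\,d\sigma_{\lambda,d}(P)\qquad\text{for all }X\in\mathscr H_d .$$ Then $\mathcal S(X)=X-\frac{a_2}{1+a_2 d}\,\mathrm{tr}(X)\,I_d$ maps $\mathscr H_d$ to $\mathscr H_d$ and $$\mathcal S\big(a_1\mathbb E(\langle \mathcal P,X\rangle \mathcal P)\big)=a_1\mathbb E(\langle\mathcal P,\mathcal S X\rangle \mathcal P)=X\qquad\text{for all }X\in\mathscr H_d .$$ -/

import Mathlib

open MeasureTheory
open scoped Matrix

namespace RandomCubature

noncomputable section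

/-! Matrices carry the Borel σ-algebra of their (entrywise) topology. -/

instance instMeasurableSpaceMatrix (d : ℕ) : MeasurableSpace (Matrix (Fin d) (Fin d) ℝ) :=
  inferInstanceAs (MeasurableSpace (Fin d → Fin d → ℝ))

instance instBorelSpaceMatrix (d : ℕ) : BorelSpace (Matrix (Fin d) (Fin d) ℝ) :=
  inferInstanceAs (BorelSpace (Fin d → Fin d → ℝ))

instance instMeasurableSpaceOrthogonal (d : ℕ) :
    MeasurableSpace (Matrix.orthogonalGroup (Fin d) ℝ) :=
  Subtype.instMeasurableSpace

instance instBorelSpaceOrthogonal (d : ℕ) :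
    BorelSpace (Matrix.orthogonalGroup (Fin d) ℝ) :=
  Subtype.borelSpace _

theorem isCompact_orthogonalGroup (d : ℕ) :
    IsCompact (Matrix.orthogonalGroup (Fin d) ℝ : Set (Matrix (Fin d) (Fin d) ℝ)) := by
  have hK : IsCompact (Set.univ.pi fun _ : Fin d => Set.univ.pi fun _ : Fin d =>
      Set.Icc (-1 : ℝ) 1) :=
    isCompact_univ_pi fun _ => isCompact_univ_pi fun _ => isCompact_Icc
  refine IsCompact.of_isClosed_subset (X := Matrix (Fin d) (Fin d) ℝ) hK ?_ ?_
  · have : (Matrix.orthogonalGroup (Fin d) ℝ : Set (Matrix (Fin d) (Fin d) ℝ)) =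
        {A | A * Aᵀ = 1} := by
      ext A
      exact Matrix.mem_orthogonalGroup_iff (Fin d) ℝ
    rw [this]
    exact isClosed_eq (by fun_prop) continuous_const
  · intro A hA i _ j _
    have h := entry_norm_bound_of_unitary hA i j
    rw [Real.norm_eq_abs] at h
    exact abs_le.mp h

instance instCompactSpaceOrthogonal (d : ℕ) :
    CompactSpace (Matrix.orthogonalGroup (Fin d) ℝ) :=
  isCompact_iff_compactSpace.mp (isCompact_orthogonalGroup d)

/-- The Haar probability measure on the orthogonal group: the Haar measure that
gives the whole (compact) group mass one. -/
def orthogonalHaar (d : ℕ) : Measure (Matrix.orthogonalGroup (Fin d) ℝ) :=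
  Measure.haarMeasure ⊤

/-- The Hilbert-Schmidt inner product `⟨X, Y⟩ = tr (X Yᵀ)`. -/
def hsInner {d : ℕ} (X Y : Matrix (Fin d) (Fin d) ℝ) : ℝ :=
  (X * Yᵀ).trace

/-- `1 ≥ l₁ ≥ … ≥ l_k > l_{k+1} = … = l_d = 0` with `1 ≤ k ≤ d`. -/
structure IsSpectrum {d : ℕ} (k : ℕ) (l : Fin d → ℝ) : Prop where
  one_le : 1 ≤ k
  le_dim : k ≤ d
  le_one : ∀ i, l i ≤ 1
  antitone : Antitone l
  pos : ∀ i : Fin d, (i : ℕ) < k → 0 < l i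
  eq_zero : ∀ i : Fin d, k ≤ (i : ℕ) → l i = 0

/-- The matrix `O D_l Oᵀ`, where `D_l = diag (l₁, …, l_d)`. -/
def conjDiag {d : ℕ} (l : Fin d → ℝ) (O : Matrix.orthogonalGroup (Fin d) ℝ) :
    Matrix (Fin d) (Fin d) ℝ :=
  (O : Matrix (Fin d) (Fin d) ℝ) * Matrix.diagonal l * (O : Matrix (Fin d) (Fin d) ℝ)ᵀ

/-- The orbit `{O D_l Oᵀ : O ∈ O(d)}`. -/
def orbit {d : ℕ} (l : Fin d → ℝ) : Set (Matrix (Fin d) (Fin d) ℝ) :=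
  Set.range (conjDiag l)

/-- The invariant probability measure on `orbit l` induced by the Haar measure on `O(d)`,
seen as a measure on the space of all matrices. -/
def orbitMeasure {d : ℕ} (l : Fin d → ℝ) : Measure (Matrix (Fin d) (Fin d) ℝ) :=
  (orthogonalHaar d).map (conjDiag l)

/-- The `t`-th trace moment `E (⟨P, X⟩ ^ t)` of a random matrix `P`. -/
def traceMoment {Ω : Type*} [MeasurableSpace Ω] {d : ℕ} (μ : Measure Ω)
    (P : Ω → Matrix (Fin d) (Fin d) ℝ) (t : ℕ) (X : Matrix (Fin d) (Fin d) ℝ) : ℝ :=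
  ∫ ω, hsInner (P ω) X ^ t ∂μ

/-- The `t`-th trace moment of the invariant measure on `orbit l`. -/
def uniformTraceMoment {d : ℕ} (l : Fin d → ℝ) (t : ℕ)
    (X : Matrix (Fin d) (Fin d) ℝ) : ℝ :=
  ∫ P, hsInner P X ^ t ∂(orbitMeasure l)

/-- `P` is a random variable with values in `orbit l` whose `t`-th trace moments
coincide with those of the invariant measure at every symmetric matrix. -/
structure IsRandomCubature {Ω : Type*} [MeasurableSpace Ω] {d : ℕ} (μ : Measure Ω)
    (l : Fin d → ℝ) (t : ℕ) (P : Ω → Matrix (Fin d) (Fin d) ℝ) : Prop where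
  measurable : Measurable P
  mem_orbit : ∀ ω, P ω ∈ orbit l
  moment_eq : ∀ X : Matrix (Fin d) (Fin d) ℝ, X.IsSymm →
    traceMoment μ P t X = uniformTraceMoment l t X

/-- The (entrywise) expectation of a random matrix. -/
def expectation {Ω : Type*} [MeasurableSpace Ω] {d : ℕ} (μ : Measure Ω)
    (Y : Ω → Matrix (Fin d) (Fin d) ℝ) : Matrix (Fin d) (Fin d) ℝ :=
  Matrix.of fun i j => ∫ ω, Y ω i j ∂μ

/-- `s_i = tr (D_l ^ i)`. -/
def powerTrace {d : ℕ} (l : Fin d → ℝ) (i : ℕ) : ℝ :=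
  (Matrix.diagonal l ^ i).trace

/-- `a₁ = d (d + 2) (d - 1) / (-2 s₁² + 2 d s₂)`. -/
def a₁ {d : ℕ} (l : Fin d → ℝ) : ℝ :=
  ((d : ℝ) * ((d : ℝ) + 2) * ((d : ℝ) - 1)) /
    (-2 * powerTrace l 1 ^ 2 + 2 * (d : ℝ) * powerTrace l 2)

/-- `a₂ = ((d + 1) s₁² - 2 s₂) / (-2 s₁² + 2 d s₂)`. -/
def a₂ {d : ℕ} (l : Fin d → ℝ) : ℝ :=
  (((d : ℝ) + 1) * powerTrace l 1 ^ 2 - 2 * powerTrace l 2) /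
    (-2 * powerTrace l 1 ^ 2 + 2 * (d : ℝ) * powerTrace l 2)

/-- `S X = X - (a₂ / (1 + a₂ d)) tr (X) I`. -/
def S {d : ℕ} (l : Fin d → ℝ) (X : Matrix (Fin d) (Fin d) ℝ) :
    Matrix (Fin d) (Fin d) ℝ :=
  X - (a₂ l / (1 + a₂ l * (d : ℝ)) * X.trace) • (1 : Matrix (Fin d) (Fin d) ℝ)

end

end RandomCubature

/-! A quadratic form on symmetric matrices invariant under orthogonal conjugation is determined by
its values on diagonal matrices, where invariance under permutation matrices forces it to be
`α ∑ xᵢ² + β (∑ xᵢ)²`; hence it equals `α ⟨X, X⟩ + β tr(X)²`. The second trace moment of the uniform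
measure on the orbit is such a form. Both `tr P = s₁` and `⟨P, P⟩ = s₂` are constant on the orbit,
which gives two linear equations for the coefficients, with solution `α = 1 / a₁` and `β = a₂ / a₁`.
A cubature of strength `2` has the same second trace moment, and polarizing it yields
`a₁ E(⟨P, X⟩ P) = X + a₂ tr(X) I`. The map on the right is inverted by `S`. -/

namespace RandomCubature

open Matrix

section InvariantForms

variable {n R : Type*} [Fintype n] [CommRing R]

theorem exists_bilinForm_eq_of_perm_invariant [Nontrivial n] {b : LinearMap.BilinForm R (n → R)}
    (hb : ∀ (σ : Equiv.Perm n) (x y : n → R), b (x ∘ σ) (y ∘ σ) = b x y) :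
    ∃ α β : R, ∀ x y, b x y = α * (x ⬝ᵥ y) + β * ((∑ i, x i) * ∑ i, y i) := by
  classical
  obtain ⟨p, q, hpq⟩ := exists_pair_ne n
  let m (i j : n) : R := b (Pi.single i 1) (Pi.single j 1)
  have hm (σ : Equiv.Perm n) (i j : n) : m (σ i) (σ j) = m i j := by
    simpa [m, Pi.single_comp_equiv] using (hb σ (Pi.single (σ i) 1) (Pi.single (σ j) 1)).symm
  have hdiag (i : n) : m i i = m p p := by
    simpa using hm (Equiv.swap p i) p p
  have hoff (i j : n) (hij : i ≠ j) : m i j = m p q := by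
    obtain ⟨σ, rfl, rfl⟩ := MulAction.is_two_pretransitive_iff.mp
      (Equiv.Perm.isMultiplyPretransitive n 2) hpq hij
    exact hm σ p q
  refine ⟨m p p - m p q, m p q, fun x y => ?_⟩
  have hform : b = (m p p - m p q) • dotProductBilin R R + m p q •
      (LinearMap.mul R R).compl₁₂ (∑ i, LinearMap.proj i) (∑ i, LinearMap.proj i) := by
    ext i j
    change m i j = _
    rcases eq_or_ne i j with rfl | hij
    · simp [hdiag, dotProductBilin]
    · simp [hoff i j hij, hij, dotProductBilin]
  rw [hform]
  simp [dotProductBilin, Finset.sum_mul_sum, Finset.sum_comm (f := fun i j => x i * y j)]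

variable [DecidableEq n]

theorem permMatrix_mem_unitaryGroup [StarRing R] (σ : Equiv.Perm n) :
    σ.permMatrix R ∈ unitaryGroup n R := by
  rw [mem_unitaryGroup_iff, star_eq_conjTranspose, conjTranspose_permMatrix, ← permMatrix_mul]
  simp

theorem conjStarAlgAut_permMatrix_diagonal [StarRing R] (σ : Equiv.Perm n) (x : n → R) :
    Unitary.conjStarAlgAut R _ ⟨σ.permMatrix R, permMatrix_mem_unitaryGroup σ⟩ (diagonal x) =
      diagonal (x ∘ σ) := by
  ext i j
  simp [star_eq_conjTranspose, Equiv.Perm.permMatrix,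
    PEquiv.toMatrix_toPEquiv_mul, PEquiv.mul_toMatrix_toPEquiv, ← Equiv.Perm.inv_def,
    diagonal_apply]

theorem trace_conjStarAlgAut [StarRing R] (U : unitaryGroup n R) (A : Matrix n n R) :
    (Unitary.conjStarAlgAut R _ U A).trace = A.trace := by
  rw [Unitary.conjStarAlgAut_apply, trace_mul_cycle, Unitary.coe_star_mul_self, one_mul]

theorem exists_quadratic_eq_of_conj_invariant [Nontrivial n]
    {B : LinearMap.BilinForm ℝ (Matrix n n ℝ)}
    (hB : ∀ (U : orthogonalGroup n ℝ) (X Y : Matrix n n ℝ),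
      B (Unitary.conjStarAlgAut ℝ _ U X) (Unitary.conjStarAlgAut ℝ _ U Y) = B X Y) :
    ∃ α β : ℝ, ∀ X : Matrix n n ℝ, X.IsSymm → B X X = α * (X * X).trace + β * X.trace ^ 2 := by
  obtain ⟨α, β, h⟩ := exists_bilinForm_eq_of_perm_invariant
    (b := B.compl₁₂ (diagonalLinearMap n ℝ ℝ) (diagonalLinearMap n ℝ ℝ)) fun σ x y => by
      have hσ := hB ⟨_, permMatrix_mem_unitaryGroup σ⟩ (diagonal x) (diagonal y)
      rwa [conjStarAlgAut_permMatrix_diagonal, conjStarAlgAut_permMatrix_diagonal] at hσ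
  refine ⟨α, β, fun X hX => ?_⟩
  have hX' : X.IsHermitian := isHermitian_iff_isSymm.mpr hX
  rw [hX'.spectral_theorem, hB, ← map_mul, trace_conjStarAlgAut, trace_conjStarAlgAut,
    diagonal_mul_diagonal, trace_diagonal, trace_diagonal, sq]
  exact h _ _

end InvariantForms

section HilbertSchmidt

variable {d : ℕ}

theorem hsInner_comm (A B : Matrix (Fin d) (Fin d) ℝ) : hsInner A B = hsInner B A := by
  rw [hsInner, ← trace_transpose, transpose_mul, transpose_transpose, hsInner]

theorem hsInner_eq_sum (A B : Matrix (Fin d) (Fin d) ℝ) :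
    hsInner A B = ∑ i, ∑ j, A i j * B i j := by
  simp [hsInner, trace, mul_apply]

theorem hsInner_add_right (A X Y : Matrix (Fin d) (Fin d) ℝ) :
    hsInner A (X + Y) = hsInner A X + hsInner A Y := by
  simp [hsInner, Matrix.mul_add]

theorem hsInner_smul_right (c : ℝ) (A X : Matrix (Fin d) (Fin d) ℝ) :
    hsInner A (c • X) = c * hsInner A X := by
  simp [hsInner]

theorem hsInner_one_right (A : Matrix (Fin d) (Fin d) ℝ) : hsInner A 1 = A.trace := by
  simp [hsInner]

theorem hsInner_single_right (A : Matrix (Fin d) (Fin d) ℝ) (i j : Fin d) :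
    hsInner A (single i j 1) = A i j := by
  simp [hsInner, trace_mul_single]

theorem hsInner_transpose_right {A : Matrix (Fin d) (Fin d) ℝ} (hA : A.IsSymm)
    (X : Matrix (Fin d) (Fin d) ℝ) : hsInner A Xᵀ = hsInner A X := by
  rw [hsInner, transpose_transpose, ← trace_transpose, transpose_mul, trace_mul_comm, hA.eq,
    hsInner]

theorem hsInner_conjStarAlgAut (U : orthogonalGroup (Fin d) ℝ)
    (A B : Matrix (Fin d) (Fin d) ℝ) :
    hsInner (Unitary.conjStarAlgAut ℝ _ U A) (Unitary.conjStarAlgAut ℝ _ U B) =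
      hsInner A B := by
  have hstar (X Y : Matrix (Fin d) (Fin d) ℝ) : hsInner X Y = (X * star Y).trace := by
    rw [hsInner, star_eq_conjTranspose, conjTranspose_eq_transpose_of_trivial]
  rw [hstar, hstar, ← map_star, ← map_mul, trace_conjStarAlgAut]

theorem continuous_hsInner (X : Matrix (Fin d) (Fin d) ℝ) :
    Continuous fun A : Matrix (Fin d) (Fin d) ℝ => hsInner A X := by
  unfold hsInner
  fun_prop

theorem eq_of_forall_isSymm_hsInner_eq {A B : Matrix (Fin d) (Fin d) ℝ} (hA : A.IsSymm)
    (hB : B.IsSymm) (h : ∀ X : Matrix (Fin d) (Fin d) ℝ, X.IsSymm → hsInner X A = hsInner X B) :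
    A = B := by
  have hzero : hsInner (A - B) (A - B) = 0 := by
    have hsub := h (A - B) (hA.sub hB)
    simp only [hsInner, transpose_sub, Matrix.mul_sub, trace_sub] at hsub ⊢
    linarith
  rw [hsInner, ← conjTranspose_eq_transpose_of_trivial,
    trace_mul_conjTranspose_self_eq_zero_iff] at hzero
  exact sub_eq_zero.mp hzero

end HilbertSchmidt

section SecondMoment

variable {Ω : Type*} [MeasurableSpace Ω] {μ : Measure Ω} {d : ℕ}
  {P : Ω → Matrix (Fin d) (Fin d) ℝ}

theorem hsInner_expectation {Y : Ω → Matrix (Fin d) (Fin d) ℝ}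
    (hY : ∀ i j, Integrable (fun ω => Y ω i j) μ) (X : Matrix (Fin d) (Fin d) ℝ) :
    hsInner X (expectation μ Y) = ∫ ω, hsInner X (Y ω) ∂μ := by
  have hint (i j : Fin d) : Integrable (fun ω => X i j * Y ω i j) μ := (hY i j).const_mul _
  simp_rw [hsInner_eq_sum]
  rw [integral_finsetSum _ fun i _ => integrable_finsetSum _ fun j _ => hint i j]
  simp_rw [integral_finsetSum _ fun j _ => hint _ j, integral_const_mul, expectation, of_apply]

/-- The bilinear form `(X, Y) ↦ E (⟨P, X⟩ ⟨P, Y⟩)` of a square integrable random matrix `P`. -/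
noncomputable def secondMoment (hP : ∀ X, MemLp (fun ω => hsInner (P ω) X) 2 μ) :
    LinearMap.BilinForm ℝ (Matrix (Fin d) (Fin d) ℝ) :=
  have hint (X Y) : Integrable (fun ω => hsInner (P ω) X * hsInner (P ω) Y) μ :=
    (hP X).integrable_mul (hP Y)
  LinearMap.mk₂ ℝ (fun X Y => ∫ ω, hsInner (P ω) X * hsInner (P ω) Y ∂μ)
    (fun X X' Y => by simp only [hsInner_add_right, add_mul, integral_add (hint _ _) (hint _ _)])
    (fun c X Y => by simp only [hsInner_smul_right, mul_assoc, integral_const_mul, smul_eq_mul])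
    (fun X Y Y' => by simp only [hsInner_add_right, mul_add, integral_add (hint _ _) (hint _ _)])
    (fun c X Y => by
      simp only [hsInner_smul_right, mul_left_comm, integral_const_mul, smul_eq_mul])

theorem secondMoment_apply (hP : ∀ X, MemLp (fun ω => hsInner (P ω) X) 2 μ)
    (X Y : Matrix (Fin d) (Fin d) ℝ) :
    secondMoment hP X Y = ∫ ω, hsInner (P ω) X * hsInner (P ω) Y ∂μ :=
  rfl

theorem secondMoment_self (hP : ∀ X, MemLp (fun ω => hsInner (P ω) X) 2 μ)
    (X : Matrix (Fin d) (Fin d) ℝ) : secondMoment hP X X = traceMoment μ P 2 X := by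
  simp only [secondMoment_apply, traceMoment, sq]

/-- The second trace moment of `P` is `α ⟨X, X⟩ + β tr(X) ^ 2` on symmetric matrices, which is
the general form of a quadratic form invariant under orthogonal conjugation. -/
def HasIsotropicSecondMoment (μ : Measure Ω) (P : Ω → Matrix (Fin d) (Fin d) ℝ) (α β : ℝ) : Prop :=
  ∀ X : Matrix (Fin d) (Fin d) ℝ, X.IsSymm →
    traceMoment μ P 2 X = α * hsInner X X + β * X.trace ^ 2

variable {α β : ℝ}

theorem secondMoment_eq_of_hasIsotropicSecondMoment (hP : ∀ X, MemLp (fun ω => hsInner (P ω) X) 2 μ)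
    (hQ : HasIsotropicSecondMoment μ P α β)
    {X Y : Matrix (Fin d) (Fin d) ℝ} (hX : X.IsSymm) (hY : Y.IsSymm) :
    secondMoment hP X Y = α * hsInner X Y + β * (X.trace * Y.trace) := by
  unfold HasIsotropicSecondMoment at hQ
  have hadd := hQ (X + Y) (hX.add hY)
  have hcomm : secondMoment hP Y X = secondMoment hP X Y := by
    simp only [secondMoment_apply, mul_comm]
  simp only [← secondMoment_self hP, map_add, LinearMap.add_apply, hcomm, hsInner_add_right,
    hsInner_comm (X + Y), trace_add] at hadd hQ
  rw [hQ X hX, hQ Y hY, hsInner_comm Y X] at hadd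
  linarith

theorem expectation_hsInner_smul (hP : ∀ X, MemLp (fun ω => hsInner (P ω) X) 2 μ)
    (hsymm : ∀ ω, (P ω).IsSymm) (hQ : HasIsotropicSecondMoment μ P α β)
    {X : Matrix (Fin d) (Fin d) ℝ} (hX : X.IsSymm) :
    expectation μ (fun ω => hsInner (P ω) X • P ω) =
      α • X + (β * X.trace) • (1 : Matrix (Fin d) (Fin d) ℝ) := by
  have hint (i j : Fin d) : Integrable (fun ω => (hsInner (P ω) X • P ω) i j) μ := by
    have hmul := (hP X).integrable_mul (hP (single i j 1))
    simp only [hsInner_single_right] at hmul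
    exact hmul
  refine eq_of_forall_isSymm_hsInner_eq ?_ ((hX.smul _).add (isSymm_one.smul _)) fun Y hY => ?_
  · ext i j
    simp only [expectation, transpose_apply, of_apply, Matrix.smul_apply, (hsymm _).apply i j]
  · calc hsInner Y (expectation μ fun ω => hsInner (P ω) X • P ω)
        = secondMoment hP X Y := by
          simp only [hsInner_expectation hint, hsInner_smul_right, secondMoment_apply,
            fun ω => hsInner_comm (P ω) Y]
      _ = α * hsInner X Y + β * (X.trace * Y.trace) :=
          secondMoment_eq_of_hasIsotropicSecondMoment hP hQ hX hY
      _ = hsInner Y (α • X + (β * X.trace) • 1) := by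
          rw [hsInner_add_right, hsInner_smul_right, hsInner_smul_right, hsInner_one_right,
            hsInner_comm Y X, mul_assoc]

theorem integral_sq_apply (hsymm : ∀ ω, (P ω).IsSymm)
    (hQ : HasIsotropicSecondMoment μ P α β) (i j : Fin d) :
    ∫ ω, P ω i j ^ 2 ∂μ = α / 2 + (α / 2 + β) * (1 : Matrix (Fin d) (Fin d) ℝ) i j := by
  let E : Matrix (Fin d) (Fin d) ℝ := single i j 1 + (single i j 1)ᵀ
  have hE {A : Matrix (Fin d) (Fin d) ℝ} (hA : A.IsSymm) : hsInner A E = 2 * A i j := by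
    rw [hsInner_add_right, hsInner_transpose_right hA, hsInner_single_right, two_mul]
  have hE_symm : E.IsSymm := isSymm_add_transpose_self _
  have hE_trace : E.trace = 2 * (1 : Matrix (Fin d) (Fin d) ℝ) i j := by
    rw [← hE isSymm_one, hsInner_comm, hsInner_one_right]
  have hE_apply : E i j = 1 + (1 : Matrix (Fin d) (Fin d) ℝ) i j := by
    simp [E, one_apply, single_apply, eq_comm]
  have hone : (1 : Matrix (Fin d) (Fin d) ℝ) i j ^ 2 = (1 : Matrix (Fin d) (Fin d) ℝ) i j := by
    simp [one_apply]
  have hmoment : 4 * ∫ ω, P ω i j ^ 2 ∂μ = α * (2 * E i j) + β * E.trace ^ 2 := by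
    rw [← hE hE_symm, ← hQ E hE_symm, traceMoment, ← integral_const_mul]
    simp only [hE (hsymm _)]
    congr with ω
    ring
  rw [hE_apply, hE_trace, mul_pow, hone] at hmoment
  linarith

theorem integral_hsInner_self (hP : ∀ X, MemLp (fun ω => hsInner (P ω) X) 2 μ)
    (hsymm : ∀ ω, (P ω).IsSymm) (hQ : HasIsotropicSecondMoment μ P α β) :
    ∫ ω, hsInner (P ω) (P ω) ∂μ = α * (d * (d + 1)) / 2 + β * d := by
  have hint (i j : Fin d) : Integrable (fun ω => P ω i j ^ 2) μ := by
    simpa only [hsInner_single_right] using (hP (single i j 1)).integrable_sq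
  simp_rw [hsInner_eq_sum, ← sq]
  rw [integral_finsetSum _ fun i _ => integrable_finsetSum _ fun j _ => hint i j]
  simp_rw [integral_finsetSum _ fun j _ => hint _ j, integral_sq_apply hsymm hQ]
  simp only [one_apply, mul_ite, mul_one, mul_zero, Finset.sum_add_distrib, Finset.sum_const,
    Finset.card_univ, Fintype.card_fin, nsmul_eq_mul, Finset.sum_ite_eq, Finset.mem_univ,
    if_true]
  ring

end SecondMoment

section Orbit

variable {d : ℕ} {l : Fin d → ℝ}

theorem conjDiag_eq_conjStarAlgAut (l : Fin d → ℝ) (O : orthogonalGroup (Fin d) ℝ) :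
    conjDiag l O = Unitary.conjStarAlgAut ℝ _ O (diagonal l) := by
  rw [conjDiag, Unitary.conjStarAlgAut_apply, star_eq_conjTranspose,
    conjTranspose_eq_transpose_of_trivial]

theorem conjDiag_mul (l : Fin d → ℝ) (U O : orthogonalGroup (Fin d) ℝ) :
    conjDiag l (U * O) = Unitary.conjStarAlgAut ℝ _ U (conjDiag l O) := by
  simp only [conjDiag_eq_conjStarAlgAut, Unitary.conjStarAlgAut_mul_apply]

theorem isSymm_conjDiag (l : Fin d → ℝ) (O : orthogonalGroup (Fin d) ℝ) :
    (conjDiag l O).IsSymm := by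
  simp [IsSymm, conjDiag, Matrix.mul_assoc]

theorem isSymm_of_mem_orbit {A : Matrix (Fin d) (Fin d) ℝ} (hA : A ∈ orbit l) : A.IsSymm := by
  obtain ⟨O, rfl⟩ := hA
  exact isSymm_conjDiag l O

theorem trace_conjDiag (l : Fin d → ℝ) (O : orthogonalGroup (Fin d) ℝ) :
    (conjDiag l O).trace = powerTrace l 1 := by
  rw [conjDiag_eq_conjStarAlgAut, trace_conjStarAlgAut, powerTrace, pow_one]

theorem hsInner_conjDiag_self (l : Fin d → ℝ) (O : orthogonalGroup (Fin d) ℝ) :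
    hsInner (conjDiag l O) (conjDiag l O) = powerTrace l 2 := by
  rw [conjDiag_eq_conjStarAlgAut, hsInner_conjStarAlgAut, hsInner, diagonal_transpose, ← sq,
    powerTrace]

theorem continuous_conjDiag (l : Fin d → ℝ) : Continuous (conjDiag l) := by
  unfold conjDiag
  fun_prop

theorem isCompact_orbit (l : Fin d → ℝ) : IsCompact (orbit l) :=
  isCompact_range (continuous_conjDiag l)

theorem memLp_hsInner_of_mem_orbit {Ω : Type*} [MeasurableSpace Ω] {μ : Measure Ω}
    [IsFiniteMeasure μ] {P : Ω → Matrix (Fin d) (Fin d) ℝ} (hP : Measurable P)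
    (hmem : ∀ ω, P ω ∈ orbit l) (p : ENNReal) (X : Matrix (Fin d) (Fin d) ℝ) :
    MemLp (fun ω => hsInner (P ω) X) p μ := by
  obtain ⟨C, hC⟩ := (isCompact_orbit l).exists_bound_of_continuousOn
    (continuous_hsInner X).continuousOn
  exact MemLp.of_bound ((continuous_hsInner X).measurable.comp hP).aestronglyMeasurable C
    (.of_forall fun ω => hC _ (hmem ω))

end Orbit

section UniformMoment

variable {d : ℕ}

instance isProbabilityMeasure_orthogonalHaar : IsProbabilityMeasure (orthogonalHaar d) :=
  ⟨Measure.haarMeasure_self⟩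

instance isMulLeftInvariant_orthogonalHaar : (orthogonalHaar d).IsMulLeftInvariant :=
  Measure.isMulLeftInvariant_haarMeasure _

theorem memLp_hsInner_conjDiag (l : Fin d → ℝ) (X : Matrix (Fin d) (Fin d) ℝ) :
    MemLp (fun O => hsInner (conjDiag l O) X) 2 (orthogonalHaar d) :=
  memLp_hsInner_of_mem_orbit (continuous_conjDiag l).measurable (fun O => ⟨O, rfl⟩) 2 X

theorem traceMoment_conjDiag (l : Fin d → ℝ) (t : ℕ) (X : Matrix (Fin d) (Fin d) ℝ) :
    traceMoment (orthogonalHaar d) (conjDiag l) t X = uniformTraceMoment l t X := by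
  rw [uniformTraceMoment, orbitMeasure, traceMoment]
  exact (integral_map (continuous_conjDiag l).measurable.aemeasurable
    ((continuous_hsInner X).pow t).aestronglyMeasurable).symm

theorem secondMoment_conjDiag_conj (l : Fin d → ℝ) (U : orthogonalGroup (Fin d) ℝ)
    (X Y : Matrix (Fin d) (Fin d) ℝ) :
    secondMoment (memLp_hsInner_conjDiag l) (Unitary.conjStarAlgAut ℝ _ U X)
      (Unitary.conjStarAlgAut ℝ _ U Y) = secondMoment (memLp_hsInner_conjDiag l) X Y := by
  rw [secondMoment_apply, ← integral_mul_left_eq_self _ U]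
  simp only [conjDiag_mul, hsInner_conjStarAlgAut, secondMoment_apply]

theorem exists_hasIsotropicSecondMoment_conjDiag [Nontrivial (Fin d)] (l : Fin d → ℝ) :
    ∃ α β : ℝ, HasIsotropicSecondMoment (orthogonalHaar d) (conjDiag l) α β := by
  obtain ⟨α, β, h⟩ := exists_quadratic_eq_of_conj_invariant (secondMoment_conjDiag_conj l)
  refine ⟨α, β, fun X hX => ?_⟩
  rw [← secondMoment_self (memLp_hsInner_conjDiag l), h X hX, hsInner, hX.eq]

end UniformMoment

section Coefficients

variable {d : ℕ} {l : Fin d → ℝ}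

theorem sum_sum_sub_sq (l : Fin d → ℝ) :
    ∑ i, ∑ j, (l i - l j) ^ 2 = -2 * powerTrace l 1 ^ 2 + 2 * d * powerTrace l 2 := by
  have hsum (t : ℕ) : powerTrace l t = ∑ i, l i ^ t := by
    simp [powerTrace, diagonal_pow]
  simp only [hsum, sub_sq, pow_one, Finset.sum_add_distrib, Finset.sum_sub_distrib,
    ← Finset.mul_sum, ← Finset.sum_mul, Finset.sum_const, Finset.card_univ, Fintype.card_fin,
    nsmul_eq_mul]
  ring

theorem a₁_denominator_pos (hne : ∃ i j, l i ≠ l j) :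
    0 < -2 * powerTrace l 1 ^ 2 + 2 * d * powerTrace l 2 := by
  obtain ⟨p, q, hpq⟩ := hne
  rw [← sum_sum_sub_sq]
  exact Finset.sum_pos' (fun i _ => Finset.sum_nonneg fun j _ => sq_nonneg _)
    ⟨p, Finset.mem_univ _, Finset.sum_pos' (fun j _ => sq_nonneg _)
      ⟨q, Finset.mem_univ _, sq_pos_of_ne_zero (sub_ne_zero.mpr hpq)⟩⟩

theorem one_lt_of_exists_ne {α : Type*} {f : Fin d → α} (hne : ∃ i j, f i ≠ f j) : 1 < d := by
  obtain ⟨i, j, hij⟩ := hne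
  exact Fin.nontrivial_iff_two_le.mp ⟨i, j, ne_of_apply_ne f hij⟩

theorem a₁_pos (hne : ∃ i j, l i ≠ l j) : 0 < a₁ l := by
  have hd : (1 : ℝ) < d := by exact_mod_cast one_lt_of_exists_ne hne
  exact div_pos (mul_pos (by positivity) (sub_pos.mpr hd)) (a₁_denominator_pos hne)

theorem one_add_a₂_mul_ne_zero (hne : ∃ i j, l i ≠ l j) (hs : powerTrace l 1 ≠ 0) :
    1 + a₂ l * d ≠ 0 := by
  have hd : (0 : ℝ) < d - 1 := sub_pos.mpr (by exact_mod_cast one_lt_of_exists_ne hne)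
  have hden := a₁_denominator_pos hne
  have h : 1 + a₂ l * d = (powerTrace l 1 ^ 2 * ((d - 1) * (d + 2))) /
      (-2 * powerTrace l 1 ^ 2 + 2 * d * powerTrace l 2) := by
    rw [a₂, div_mul_eq_mul_div, one_add_div hden.ne']
    ring
  rw [h]
  positivity

theorem hasIsotropicSecondMoment_conjDiag (hne : ∃ i j, l i ≠ l j) :
    HasIsotropicSecondMoment (orthogonalHaar d) (conjDiag l) (a₁ l)⁻¹ ((a₁ l)⁻¹ * a₂ l) := by
  have : Nontrivial (Fin d) := Fin.nontrivial_iff_two_le.mpr (one_lt_of_exists_ne hne)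
  obtain ⟨α, β, hQ⟩ := exists_hasIsotropicSecondMoment_conjDiag l
  have htrace : powerTrace l 1 ^ 2 = α * d + β * d ^ 2 := by
    simpa [traceMoment, hsInner_one_right, trace_conjDiag] using hQ 1 isSymm_one
  have hnorm : powerTrace l 2 = α * (d * (d + 1)) / 2 + β * d := by
    rw [← integral_hsInner_self (memLp_hsInner_conjDiag l) (isSymm_conjDiag l) hQ]
    simp [hsInner_conjDiag_self]
  have hden := (a₁_denominator_pos hne).ne'
  have hα : a₁ l * α = 1 := by
    rw [a₁, div_mul_eq_mul_div, div_eq_one_iff_eq hden, htrace, hnorm]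
    ring
  have hβ : a₁ l * β = a₂ l := by
    rw [a₁, a₂, div_mul_eq_mul_div, div_left_inj' hden, htrace, hnorm]
    ring
  rwa [← hβ, inv_mul_cancel_left₀ (a₁_pos hne).ne', ← eq_inv_of_mul_eq_one_right hα]

end Coefficients

section Reconstruction

variable {d : ℕ} {l : Fin d → ℝ}

theorem IsRandomCubature.hasIsotropicSecondMoment {Ω : Type*} [MeasurableSpace Ω]
    {μ : Measure Ω} (hne : ∃ i j, l i ≠ l j) {P : Ω → Matrix (Fin d) (Fin d) ℝ}
    (hP : IsRandomCubature μ l 2 P) :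
    HasIsotropicSecondMoment μ P (a₁ l)⁻¹ ((a₁ l)⁻¹ * a₂ l) := fun X hX => by
  rw [hP.moment_eq X hX, ← traceMoment_conjDiag, hasIsotropicSecondMoment_conjDiag hne X hX]

theorem IsRandomCubature.a₁_smul_expectation {Ω : Type*} [MeasurableSpace Ω] {μ : Measure Ω}
    [IsFiniteMeasure μ] (hne : ∃ i j, l i ≠ l j) {P : Ω → Matrix (Fin d) (Fin d) ℝ}
    (hP : IsRandomCubature μ l 2 P) {X : Matrix (Fin d) (Fin d) ℝ} (hX : X.IsSymm) :
    a₁ l • expectation μ (fun ω => hsInner (P ω) X • P ω) =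
      X + (a₂ l * X.trace) • (1 : Matrix (Fin d) (Fin d) ℝ) := by
  have hmemLp := memLp_hsInner_of_mem_orbit (μ := μ) hP.measurable hP.mem_orbit 2
  have hsymm (ω : Ω) : (P ω).IsSymm := isSymm_of_mem_orbit (hP.mem_orbit ω)
  rw [expectation_hsInner_smul hmemLp hsymm (hP.hasIsotropicSecondMoment hne) hX, mul_assoc,
    mul_smul, ← smul_add, smul_inv_smul₀ (a₁_pos hne).ne']

theorem isSymm_S (l : Fin d → ℝ) {X : Matrix (Fin d) (Fin d) ℝ} (hX : X.IsSymm) :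
    (S l X).IsSymm :=
  hX.sub (isSymm_one.smul _)

theorem S_add_trace_smul_one (h : 1 + a₂ l * d ≠ 0) (X : Matrix (Fin d) (Fin d) ℝ) :
    S l (X + (a₂ l * X.trace) • (1 : Matrix (Fin d) (Fin d) ℝ)) = X := by
  have htrace : (X + (a₂ l * X.trace) • (1 : Matrix (Fin d) (Fin d) ℝ)).trace =
      (1 + a₂ l * d) * X.trace := by
    simp only [trace_add, trace_smul, trace_one, Fintype.card_fin, smul_eq_mul]
    ring
  rw [S, htrace, ← mul_assoc, div_mul_cancel₀ _ h, add_sub_cancel_right]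

theorem S_add_trace_S_smul_one (h : 1 + a₂ l * d ≠ 0) (X : Matrix (Fin d) (Fin d) ℝ) :
    S l X + (a₂ l * (S l X).trace) • (1 : Matrix (Fin d) (Fin d) ℝ) = X := by
  have htrace : a₂ l * (S l X).trace = a₂ l / (1 + a₂ l * d) * X.trace := by
    simp only [S, trace_sub, trace_smul, trace_one, Fintype.card_fin, smul_eq_mul]
    field_simp
    ring
  rw [htrace, S, sub_add_cancel]

end Reconstruction

namespace IsSpectrum

variable {d k : ℕ} {l : Fin d → ℝ}

theorem nonneg (hl : IsSpectrum k l) (i : Fin d) : 0 ≤ l i :=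
  (lt_or_ge (i : ℕ) k).elim (fun h => (hl.pos i h).le) fun h => (hl.eq_zero i h).ge

theorem powerTrace_one_pos (hl : IsSpectrum k l) : 0 < powerTrace l 1 := by
  have h0 : 0 < d := hl.one_le.trans hl.le_dim
  rw [powerTrace, pow_one, trace_diagonal]
  exact Finset.sum_pos' (fun i _ => hl.nonneg i)
    ⟨⟨0, h0⟩, Finset.mem_univ _, hl.pos ⟨0, h0⟩ hl.one_le⟩

theorem exists_ne (hl : IsSpectrum k l) (hne : k = d → ∃ i j, l i ≠ l j) :
    ∃ i j, l i ≠ l j := by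
  rcases hl.le_dim.eq_or_lt with hk | hk
  · exact hne hk
  · refine ⟨⟨0, by lia⟩, ⟨k, hk⟩, ?_⟩
    rw [hl.eq_zero ⟨k, hk⟩ le_rfl]
    exact (hl.pos ⟨0, _⟩ hl.one_le).ne'

end IsSpectrum

end RandomCubature

theorem corollary7p5_general {Ω : Type*} [MeasurableSpace Ω] {μ : MeasureTheory.Measure Ω}
    [MeasureTheory.IsFiniteMeasure μ] {d : ℕ} {l : Fin d → ℝ} (hne : ∃ i j, l i ≠ l j)
    (hs : RandomCubature.powerTrace l 1 ≠ 0) {P : Ω → Matrix (Fin d) (Fin d) ℝ}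
    (hP : RandomCubature.IsRandomCubature μ l 2 P) {X : Matrix (Fin d) (Fin d) ℝ}
    (hX : X.IsSymm) :
    (RandomCubature.S l X).IsSymm ∧
    RandomCubature.S l (RandomCubature.a₁ l •
        RandomCubature.expectation μ (fun ω => RandomCubature.hsInner (P ω) X • P ω)) = X ∧
    RandomCubature.a₁ l • RandomCubature.expectation μ
        (fun ω => RandomCubature.hsInner (P ω) (RandomCubature.S l X) • P ω) = X := by
  have h := RandomCubature.one_add_a₂_mul_ne_zero hne hs
  have hSX := RandomCubature.isSymm_S l hX
  refine ⟨hSX, ?_, ?_⟩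
  · rw [hP.a₁_smul_expectation hne hX, RandomCubature.S_add_trace_smul_one h]
  · rw [hP.a₁_smul_expectation hne hSX, RandomCubature.S_add_trace_S_smul_one h]

/-- The last hypothesis, that the entries of `l` are not all equal, is only required if
`k = d`; for `k < d` it holds automatically. -/
theorem corollary7p5 {Ω : Type*} [MeasurableSpace Ω] (μ : MeasureTheory.Measure Ω)
    [MeasureTheory.IsProbabilityMeasure μ] (d k : ℕ) (hd : 2 ≤ d) (l : Fin d → ℝ)
    (hl : RandomCubature.IsSpectrum k l) (hne : k = d → ∃ i j, l i ≠ l j)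
    (P : Ω → Matrix (Fin d) (Fin d) ℝ) (hP : RandomCubature.IsRandomCubature μ l 2 P)
    (X : Matrix (Fin d) (Fin d) ℝ) (hX : X.IsSymm) :
    (RandomCubature.S l X).IsSymm ∧
    RandomCubature.S l (RandomCubature.a₁ l •
        RandomCubature.expectation μ (fun ω => RandomCubature.hsInner (P ω) X • P ω)) = X ∧
    RandomCubature.a₁ l • RandomCubature.expectation μ
        (fun ω => RandomCubature.hsInner (P ω) (RandomCubature.S l X) • P ω) = X :=
  corollary7p5_general (hl.exists_ne hne) hl.powerTrace_one_pos.ne' hP hX
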